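/- **Model.** Let $H$ be a Hermitian matrix on $n$ qubits and $U=e^{-iH}$. A phase-estimation algorithm acts on one ancilla qubit and the $n$-qubit system register. It may apply arbitrary one-qubit unitary gates to the ancilla, apply $|0\rangle\langle 0|\otimes I+|1\rangle\langle 1|\otimes U$ (controlled $U$) and its inverse, and measure the ancilla in the computational basis. Its next steps may depend on the earlier measurement outcomes, and at the end it outputs a real number $\hat\lambda$. The system register is touched only through controlled $U$ and its inverse. Numbers of queries and of gates are worst-case over measurement outcomes. **Corollary (phase estimation).** For every constant $\eta>0$ there are $C>0$ and $k\in\mathbb{N}$ (depending only on $\eta$) such that for all $0<\epsilon<1/e$ and $0<\vartheta\le 1/2$ there is an algorithm of this kind, depending only on $\eta,\epsilon,\vartheta$, such that: 1. it uses at most $C\,g\,(1+\log g)^k$ applications of controlled $U$ and its inverse, where $g=\epsilon^{-1}\log(\vartheta^{-1})$, i.e. $\widetilde{\mathcal O}(\epsilon^{-1}\log(\vartheta^{-1}))$ (Heisenberg-limited scaling in $\epsilon$); 2. it uses at most $C\,\epsilon^{-1}\big(\log(\vartheta^{-1})+\log\log(\epsilon^{-1})\big)$ one-qubit gates; 3.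 for every $n$, every Hermitian $H$ on $n$ qubits, every unit vector $|\psi\rangle$ and every $\lambda\in[\eta,\pi-\eta]$ with $U|\psi\rangle=e^{-i\lambda}|\psi\rangle$, the algorithm run with $U=e^{-iH}$ from $|0\rangle\otimes|\psi\rangle$ (a single copy of $|\psi\rangle$) outputs $\hat\lambda$ with $|\hat\lambda-\lambda|\le\epsilon$ with probability at least $1-\vartheta$. -/

import Mathlib

open scoped Kronecker Matrix

namespace PhaseEstimation

/-- The computational basis of `n` qubits: bit strings of length `n`. -/
abbrev Basis (n : ℕ) : Type := Fin n → Fin 2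

/-- Operators on `n` qubits, as matrices in the computational basis. -/
abbrev Op (n : ℕ) : Type := Matrix (Basis n) (Basis n) ℂ

/-- State vectors of one ancilla qubit (first factor) and `n` system qubits (second factor). -/
abbrev State (n : ℕ) : Type := Fin 2 × Basis n → ℂ

/-- Squared Euclidean (Hilbert space) norm of a vector of amplitudes. -/
noncomputable def normSq {ι : Type*} [Fintype ι] (v : ι → ℂ) : ℝ := ∑ i, ‖v i‖ ^ 2

/-- The time evolution operator `U = exp(-iH)`. -/
noncomputable def evolution {n : ℕ} (H : Op n) : Op n := NormedSpace.exp ((-Complex.I) • H)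

/-- The one-qubit operator `V` applied to the ancilla: `V ⊗ I`. -/
def onAncilla (n : ℕ) (V : Matrix (Fin 2) (Fin 2) ℂ) :
    Matrix (Fin 2 × Basis n) (Fin 2 × Basis n) ℂ :=
  V ⊗ₖ (1 : Op n)

/-- The projector `|b⟩⟨b|` on one qubit. -/
def proj (b : Fin 2) : Matrix (Fin 2) (Fin 2) ℂ := Matrix.single b b 1

/-- The controlled operator `|0⟩⟨0| ⊗ I + |1⟩⟨1| ⊗ W`, controlled by the ancilla. -/
def controlled {n : ℕ} (W : Op n) : Matrix (Fin 2 × Basis n) (Fin 2 × Basis n) ℂ :=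
  proj 0 ⊗ₖ (1 : Op n) + proj 1 ⊗ₖ W

/-- The initial state `|0⟩ ⊗ |ψ⟩`. -/
def initial {n : ℕ} (ψ : Basis n → ℂ) : State n := fun x => if x.1 = 0 then ψ x.2 else 0

/-- An adaptive quantum algorithm with black-box access to a unitary `U`. It acts on one ancilla
qubit and on a system register that it can touch only through controlled `U` and its inverse.
Mid-circuit measurements of the ancilla steer the rest of the computation, which ends with a
classical real number. An algorithm contains no reference to the unitary `U`, to the input state
or to the number of system qubits. -/
inductive Algorithm : Type
  /-- Stop and return the real number `r`. -/
  | output (r : ℝ) : Algorithm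
  /-- Apply the one-qubit unitary gate `V` to the ancilla, then continue. -/
  | gate (V : Matrix.unitaryGroup (Fin 2) ℂ) (next : Algorithm) : Algorithm
  /-- Apply controlled `U`, then continue. -/
  | query (next : Algorithm) : Algorithm
  /-- Apply controlled `U` inverse, then continue. -/
  | queryInv (next : Algorithm) : Algorithm
  /-- Measure the ancilla in the computational basis; continue with `next₀` if the outcome is `0`
  and with `next₁` if it is `1`. The ancilla stays in the observed basis state. -/
  | measure (next₀ next₁ : Algorithm) : Algorithm

namespace Algorithm

/-- Number of applications of controlled `U` and its inverse, in the worst case over the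
measurement outcomes. -/
def queries : Algorithm → ℕ
  | output _ => 0
  | gate _ A => A.queries
  | query A => A.queries + 1
  | queryInv A => A.queries + 1
  | measure A₀ A₁ => max A₀.queries A₁.queries

/-- Number of one-qubit gates, in the worst case over the measurement outcomes. -/
def gates : Algorithm → ℕ
  | output _ => 0
  | gate _ A => A.gates + 1
  | query A => A.gates
  | queryInv A => A.gates
  | measure A₀ A₁ => max A₀.gates A₁.gates

open Classical in
/-- Born rule: the probability that the algorithm, run with the unitary `U` from the state `v`,
returns a number in `S`. After a measurement the projected state is kept unnormalized, so that the
squared norm of the state on a branch is the probability of that branch. -/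
noncomputable def prob {n : ℕ} (U : Op n) (S : Set ℝ) : Algorithm → State n → ℝ
  | output r, v => if r ∈ S then normSq v else 0
  | gate V A, v => prob U S A (onAncilla n (V : Matrix (Fin 2) (Fin 2) ℂ) *ᵥ v)
  | query A, v => prob U S A (controlled U *ᵥ v)
  | queryInv A, v => prob U S A (controlled Uᴴ *ᵥ v)
  | measure A₀ A₁, v =>
      prob U S A₀ (onAncilla n (proj 0) *ᵥ v) + prob U S A₁ (onAncilla n (proj 1) *ᵥ v)

end Algorithm

end PhaseEstimation

namespace PhaseEstimation

/-! On an eigenvector the system register never changes, so a Hadamard test is a coin whose bias is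
the cosine of `φ - m * lam`. The phase is located by ternary search: with `[a, a + L]` known to
contain `lam`, a test with `m ≈ π / L` centred at the midpoint has bias at least `1/6` towards the
correct side unless `lam` lies in the middle third, where discarding either outer third is harmless
(`le_prob_search`). A majority of `N` tests fails with probability at most `(71/72)^N`
(`le_prob_vote_of_left`, `le_prob_vote_of_right`), and failures add up over `T` rounds.

The powers `m` grow geometrically, so queries total `O(N / ε)`, while gates total `O(N T)`. Taking
`T` of order `log ε⁻¹` and `N` of order `log T + log ϑ⁻¹` gives both bounds. The hypothesis on `lam`
enters only through `lam ∈ [0, π]`, the initial interval, so the constants do not depend on `η`. -/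

/-! ### Product states and one-qubit gates -/

/-- The product state `u ⊗ ψ`. -/
def prodState {n : ℕ} (u : Fin 2 → ℂ) (ψ : Basis n → ℂ) : State n := fun x => u x.1 * ψ x.2

theorem initial_eq_prodState {n : ℕ} (ψ : Basis n → ℂ) : initial ψ = prodState ![1, 0] ψ := by
  ext ⟨b, x⟩
  fin_cases b <;> simp [initial, prodState]

theorem kronecker_mulVec_prodState {n : ℕ} (V : Matrix (Fin 2) (Fin 2) ℂ) (W : Op n)
    (u : Fin 2 → ℂ) (ψ : Basis n → ℂ) :
    (V ⊗ₖ W) *ᵥ prodState u ψ = prodState (V *ᵥ u) (W *ᵥ ψ) := by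
  ext ⟨b, x⟩
  simp only [Matrix.mulVec, dotProduct, prodState, Matrix.kroneckerMap_apply,
    Fintype.sum_prod_type, Finset.sum_mul_sum]
  refine Finset.sum_congr rfl fun i _ => Finset.sum_congr rfl fun j _ => ?_
  ring

theorem onAncilla_mulVec_prodState {n : ℕ} (V : Matrix (Fin 2) (Fin 2) ℂ)
    (u : Fin 2 → ℂ) (ψ : Basis n → ℂ) :
    onAncilla n V *ᵥ prodState u ψ = prodState (V *ᵥ u) ψ := by
  rw [onAncilla, kronecker_mulVec_prodState, Matrix.one_mulVec]

theorem controlled_mulVec_prodState {n : ℕ} {U : Op n} {ψ : Basis n → ℂ} {μ : ℂ}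
    (h : U *ᵥ ψ = μ • ψ) (u : Fin 2 → ℂ) :
    controlled U *ᵥ prodState u ψ = prodState ![u 0, μ * u 1] ψ := by
  rw [controlled, Matrix.add_mulVec, kronecker_mulVec_prodState, kronecker_mulVec_prodState, h,
    Matrix.one_mulVec]
  ext ⟨b, x⟩
  fin_cases b <;>
    simp [prodState, proj]
  ring

theorem normSq_smul {ι : Type*} [Fintype ι] (c : ℂ) (v : ι → ℂ) :
    normSq (c • v) = ‖c‖ ^ 2 * normSq v := by
  simp [normSq, mul_pow, Finset.mul_sum]

theorem normSq_nonneg {ι : Type*} [Fintype ι] (v : ι → ℂ) : 0 ≤ normSq v :=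
  Finset.sum_nonneg fun _ _ => by positivity

theorem normSq_initial {n : ℕ} (ψ : Basis n → ℂ) : normSq (initial ψ) = normSq ψ := by
  simp [normSq, initial, Fintype.sum_prod_type]

/-- The gate `(1/√2) [[1, e^{iφ}], [1, -e^{iφ}]]`: a phase followed by a Hadamard gate. -/
noncomputable def phaseHadamardMatrix (φ : ℝ) : Matrix (Fin 2) (Fin 2) ℂ :=
  !![((√2 : ℝ) : ℂ)⁻¹, ((√2 : ℝ) : ℂ)⁻¹ * Complex.exp (φ * Complex.I);
    ((√2 : ℝ) : ℂ)⁻¹, -(((√2 : ℝ) : ℂ)⁻¹ * Complex.exp (φ * Complex.I))]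

theorem inv_sqrt_two_mul_self : ((√2 : ℝ) : ℂ)⁻¹ * ((√2 : ℝ) : ℂ)⁻¹ = 1 / 2 := by
  rw [← mul_inv, ← Complex.ofReal_mul, Real.mul_self_sqrt (by norm_num)]
  norm_num

theorem exp_mul_conj_exp (φ : ℝ) :
    Complex.exp (φ * Complex.I) * (starRingEnd ℂ) (Complex.exp (φ * Complex.I)) = 1 := by
  rw [Complex.mul_conj, Complex.normSq_eq_norm_sq, Complex.norm_exp_ofReal_mul_I]
  norm_num

theorem phaseHadamardMatrix_mem (φ : ℝ) :
    phaseHadamardMatrix φ ∈ Matrix.unitaryGroup (Fin 2) ℂ := by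
  rw [Matrix.mem_unitaryGroup_iff]
  have h := inv_sqrt_two_mul_self
  have he := exp_mul_conj_exp φ
  have hs : (starRingEnd ℂ) ((√2 : ℝ) : ℂ) = ((√2 : ℝ) : ℂ) := Complex.conj_ofReal _
  rw [phaseHadamardMatrix]
  generalize Complex.exp (φ * Complex.I) = z at *
  generalize ((√2 : ℝ) : ℂ) = r at *
  ext i j
  fin_cases i <;> fin_cases j <;>
    simp [Matrix.mul_apply, Matrix.star_apply, hs, -mul_inv_rev]
  · linear_combination 2 * h + r⁻¹ * r⁻¹ * he
  · linear_combination -(r⁻¹ * r⁻¹ * he)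
  · linear_combination -(r⁻¹ * r⁻¹ * he)
  · linear_combination 2 * h + r⁻¹ * r⁻¹ * he

/-- A phase gate followed by a Hadamard gate. -/
noncomputable def phaseHadamard (φ : ℝ) : Matrix.unitaryGroup (Fin 2) ℂ :=
  ⟨phaseHadamardMatrix φ, phaseHadamardMatrix_mem φ⟩

theorem flipMatrix_mem : (!![0, 1; 1, 0] : Matrix (Fin 2) (Fin 2) ℂ) ∈
    Matrix.unitaryGroup (Fin 2) ℂ := by
  rw [Matrix.mem_unitaryGroup_iff]
  ext i j
  fin_cases i <;> fin_cases j <;> simp [Matrix.mul_apply, Matrix.star_apply]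

/-- The Pauli `X` gate. -/
def flipGate : Matrix.unitaryGroup (Fin 2) ℂ := ⟨!![0, 1; 1, 0], flipMatrix_mem⟩

namespace Algorithm

/-! ### Hadamard tests as biased coins -/

theorem prob_nonneg {n : ℕ} (U : Op n) (S : Set ℝ) (A : Algorithm) (v : State n) :
    0 ≤ prob U S A v := by
  induction A generalizing v with
  | output r =>
    rw [prob]
    split_ifs
    exacts [normSq_nonneg v, le_rfl]
  | gate V A ih => exact ih _
  | query A ih => exact ih _
  | queryInv A ih => exact ih _
  | measure A₀ A₁ ih₀ ih₁ => exact add_nonneg (ih₀ _) (ih₁ _)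

/-- Branch states are unnormalized; homogeneity turns their scalar amplitudes into branch
probabilities. -/
theorem prob_smul {n : ℕ} (U : Op n) (S : Set ℝ) (A : Algorithm) (c : ℂ) (v : State n) :
    prob U S A (c • v) = ‖c‖ ^ 2 * prob U S A v := by
  induction A generalizing v with
  | output r =>
    simp only [prob]
    split_ifs
    exacts [normSq_smul c v, (mul_zero _).symm]
  | gate V A ih => simp only [prob, Matrix.mulVec_smul, ih]
  | query A ih => simp only [prob, Matrix.mulVec_smul, ih]
  | queryInv A ih => simp only [prob, Matrix.mulVec_smul, ih]
  | measure A₀ A₁ ih₀ ih₁ => simp only [prob, Matrix.mulVec_smul, ih₀, ih₁, mul_add]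

/-- Apply controlled `U` `m` times, then continue with `A`. -/
def queryPow : ℕ → Algorithm → Algorithm
  | 0, A => A
  | m + 1, A => query (queryPow m A)

theorem queries_queryPow (m : ℕ) (A : Algorithm) : (queryPow m A).queries = A.queries + m := by
  induction m with
  | zero => rfl
  | succ m ih => rw [queryPow, queries, ih, add_assoc]

theorem gates_queryPow (m : ℕ) (A : Algorithm) : (queryPow m A).gates = A.gates := by
  induction m with
  | zero => rfl
  | succ m ih => rw [queryPow, gates, ih]

theorem prob_queryPow {n : ℕ} {U : Op n} {ψ : Basis n → ℂ} {μ : ℂ} (h : U *ᵥ ψ = μ • ψ)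
    (S : Set ℝ) (m : ℕ) (A : Algorithm) (u : Fin 2 → ℂ) :
    prob U S (queryPow m A) (prodState u ψ) = prob U S A (prodState ![u 0, μ ^ m * u 1] ψ) := by
  induction m generalizing u with
  | zero =>
    rw [queryPow, pow_zero, one_mul]
    congr 2
    ext i
    fin_cases i <;> rfl
  | succ m ih =>
    rw [queryPow, prob, controlled_mulVec_prodState h, ih]
    simp [pow_succ, mul_assoc]

/-- The Hadamard test for `e^{iφ} U^m`, with the ancilla reset to `|0⟩` afterwards. -/
noncomputable def hadamardTest (m : ℕ) (φ : ℝ) (A₀ A₁ : Algorithm) : Algorithm :=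
  gate (phaseHadamard 0) (queryPow m (gate (phaseHadamard φ) (measure A₀ (gate flipGate A₁))))

theorem queries_hadamardTest (m : ℕ) (φ : ℝ) (A₀ A₁ : Algorithm) :
    (hadamardTest m φ A₀ A₁).queries = max A₀.queries A₁.queries + m := by
  simp [hadamardTest, queries, queries_queryPow]

theorem gates_hadamardTest_le (m : ℕ) (φ : ℝ) (A₀ A₁ : Algorithm) :
    (hadamardTest m φ A₀ A₁).gates ≤ max A₀.gates A₁.gates + 3 := by
  simp only [hadamardTest, gates, gates_queryPow]
  omega

/-- Both branches return to multiples of the initial state, with amplitudes `(1 ± z) / 2` for `z =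
exp (i (φ - m * lam))`; hence tests compose like independent coin flips. -/
theorem prob_hadamardTest {n : ℕ} {U : Op n} {ψ : Basis n → ℂ} {lam : ℝ}
    (h : U *ᵥ ψ = Complex.exp (-Complex.I * lam) • ψ) (S : Set ℝ) (m : ℕ) (φ : ℝ)
    (A₀ A₁ : Algorithm) :
    prob U S (hadamardTest m φ A₀ A₁) (initial ψ) =
      (1 + Real.cos (φ - m * lam)) / 2 * prob U S A₀ (initial ψ) +
      (1 - Real.cos (φ - m * lam)) / 2 * prob U S A₁ (initial ψ) := by
  set z : ℂ := Complex.exp (((φ - m * lam : ℝ) : ℂ) * Complex.I) with hz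
  have hzn : ‖z‖ = 1 := Complex.norm_exp_ofReal_mul_I _
  have hzre : z.re = Real.cos (φ - m * lam) := Complex.exp_ofReal_mul_I_re _
  have hzn2 : z.re ^ 2 + z.im ^ 2 = 1 := by
    have := Complex.sq_norm z
    rw [hzn, Complex.normSq_apply] at this
    nlinarith
  have hmul : Complex.exp (φ * Complex.I) * Complex.exp (-Complex.I * lam) ^ m = z := by
    rw [← Complex.exp_nat_mul, ← Complex.exp_add, hz]
    congr 1
    push_cast
    ring
  have hs := inv_sqrt_two_mul_self
  have key : prob U S (hadamardTest m φ A₀ A₁) (initial ψ) =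
      prob U S A₀ (((1 + z) / 2) • initial ψ) + prob U S A₁ (((1 - z) / 2) • initial ψ) := by
    rw [hadamardTest, prob, initial_eq_prodState, onAncilla_mulVec_prodState, prob_queryPow h,
      prob, onAncilla_mulVec_prodState, prob, prob, onAncilla_mulVec_prodState,
      onAncilla_mulVec_prodState, onAncilla_mulVec_prodState]
    congr 2
    · ext ⟨b, x⟩
      fin_cases b
      · simp [prodState, proj, phaseHadamard, phaseHadamardMatrix, Matrix.mulVec, dotProduct,
          Matrix.single_apply, -mul_inv_rev, -neg_mul]
        left
        linear_combination (1 + z) * hs +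
          ((√2 : ℝ) : ℂ)⁻¹ * ((√2 : ℝ) : ℂ)⁻¹ * hmul
      · simp [prodState, proj, phaseHadamard, Matrix.mulVec, dotProduct]
    · ext ⟨b, x⟩
      fin_cases b
      · simp [prodState, proj, flipGate, phaseHadamard, phaseHadamardMatrix, Matrix.mulVec,
          dotProduct, Matrix.single_apply, -mul_inv_rev, -neg_mul]
        left
        linear_combination (1 - z) * hs -
          ((√2 : ℝ) : ℂ)⁻¹ * ((√2 : ℝ) : ℂ)⁻¹ * hmul
      · simp [prodState, proj, flipGate, phaseHadamard, Matrix.mulVec, dotProduct,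
          Matrix.single_apply]
  have h0 : ‖(1 + z) / 2‖ ^ 2 = (1 + Real.cos (φ - m * lam)) / 2 := by
    rw [Complex.sq_norm, Complex.normSq_apply, ← hzre]
    simp
    linear_combination hzn2 / 4
  have h1 : ‖(1 - z) / 2‖ ^ 2 = (1 - Real.cos (φ - m * lam)) / 2 := by
    rw [Complex.sq_norm, Complex.normSq_apply, ← hzre]
    simp
    linear_combination hzn2 / 4
  rw [key, prob_smul, prob_smul, h0, h1]

/-! ### Majority votes -/

/-- Majority vote over `N` Hadamard tests, where `s` is the current lead of the outcome `1`. -/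
noncomputable def vote (m : ℕ) (φ : ℝ) (A₀ A₁ : Algorithm) : ℕ → ℤ → Algorithm
  | 0, s => if 0 < s then A₁ else A₀
  | N + 1, s => hadamardTest m φ (vote m φ A₀ A₁ N (s - 1)) (vote m φ A₀ A₁ N (s + 1))

theorem queries_vote_le (m : ℕ) (φ : ℝ) (A₀ A₁ : Algorithm) (N : ℕ) (s : ℤ) :
    (vote m φ A₀ A₁ N s).queries ≤ max A₀.queries A₁.queries + N * m := by
  induction N generalizing s with
  | zero => rw [vote]; split_ifs <;> simp
  | succ N ih =>
    rw [vote, queries_hadamardTest, add_mul, one_mul, ← add_assoc]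
    exact Nat.add_le_add_right (max_le (ih _) (ih _)) m

theorem gates_vote_le (m : ℕ) (φ : ℝ) (A₀ A₁ : Algorithm) (N : ℕ) (s : ℤ) :
    (vote m φ A₀ A₁ N s).gates ≤ max A₀.gates A₁.gates + N * 3 := by
  induction N generalizing s with
  | zero => rw [vote]; split_ifs <;> simp
  | succ N ih =>
    rw [vote, add_mul, one_mul, ← add_assoc]
    exact (gates_hadamardTest_le _ _ _ _).trans (Nat.add_le_add_right (max_le (ih _) (ih _)) 3)

section Vote

variable {n : ℕ} {U : Op n} {ψ : Basis n → ℂ} {lam : ℝ}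

theorem le_prob_vote_of_both (h : U *ᵥ ψ = Complex.exp (-Complex.I * lam) • ψ) (S : Set ℝ)
    (m : ℕ) (φ : ℝ) {A₀ A₁ : Algorithm} {q : ℝ} (h₀ : q ≤ prob U S A₀ (initial ψ))
    (h₁ : q ≤ prob U S A₁ (initial ψ)) (N : ℕ) (s : ℤ) :
    q ≤ prob U S (vote m φ A₀ A₁ N s) (initial ψ) := by
  induction N generalizing s with
  | zero => rw [vote]; split_ifs <;> assumption
  | succ N ih =>
    rw [vote, prob_hadamardTest h]
    have hc := Real.neg_one_le_cos (φ - m * lam)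
    have hc' := Real.cos_le_one (φ - m * lam)
    nlinarith [mul_le_mul_of_nonneg_left (ih (s - 1))
      (by linarith : 0 ≤ (1 + Real.cos (φ - m * lam)) / 2),
      mul_le_mul_of_nonneg_left (ih (s + 1))
      (by linarith : 0 ≤ (1 - Real.cos (φ - m * lam)) / 2)]

/-- Chernoff bound for a vote biased towards the outcome `0`. -/
theorem le_prob_vote_of_left (h : U *ᵥ ψ = Complex.exp (-Complex.I * lam) • ψ) (S : Set ℝ)
    {m : ℕ} {φ : ℝ} {A₀ : Algorithm} (A₁ : Algorithm) {q : ℝ} (hq : q ≤ 1)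
    (h₀ : q ≤ prob U S A₀ (initial ψ)) (hφ : 1 / 6 ≤ Real.cos (φ - m * lam)) (N : ℕ) (s : ℤ) :
    q - (7 / 6 : ℝ) ^ s * (71 / 72) ^ N ≤ prob U S (vote m φ A₀ A₁ N s) (initial ψ) := by
  induction N generalizing s with
  | zero =>
    rw [vote, pow_zero, mul_one]
    split_ifs with hs
    · have := one_le_zpow₀ (by norm_num : (1 : ℝ) ≤ 7 / 6) hs.le
      exact le_trans (by linarith) (prob_nonneg U S A₁ _)
    · have : (0 : ℝ) < (7 / 6) ^ s := by positivity
      linarith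
  | succ N ih =>
    rw [vote, prob_hadamardTest h]
    have hc' := Real.cos_le_one (φ - m * lam)
    have i₀ := mul_le_mul_of_nonneg_left (ih (s - 1))
      (by linarith : 0 ≤ (1 + Real.cos (φ - m * lam)) / 2)
    have i₁ := mul_le_mul_of_nonneg_left (ih (s + 1))
      (by linarith : 0 ≤ (1 - Real.cos (φ - m * lam)) / 2)
    rw [zpow_sub_one₀ (by norm_num)] at i₀
    rw [zpow_add_one₀ (by norm_num)] at i₁
    refine le_trans ?_ (add_le_add i₀ i₁)
    -- The potential `(7/6)^s` shrinks on average: at cosine `1/6` the factor is `7/12 * 6/7 + 5/12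
    -- * 7/6 = 71/72`, and a larger cosine only lowers it.
    have : (0 : ℝ) < (7 / 6) ^ s * (71 / 72) ^ N := by positivity
    rw [pow_succ]
    nlinarith [mul_nonneg this.le (sub_nonneg.2 hφ)]

/-- Chernoff bound for a vote biased towards the outcome `1`. -/
theorem le_prob_vote_of_right (h : U *ᵥ ψ = Complex.exp (-Complex.I * lam) • ψ) (S : Set ℝ)
    {m : ℕ} {φ : ℝ} (A₀ : Algorithm) {A₁ : Algorithm} {q : ℝ} (hq : q ≤ 1)
    (h₁ : q ≤ prob U S A₁ (initial ψ)) (hφ : Real.cos (φ - m * lam) ≤ -(1 / 6)) (N : ℕ) (s : ℤ) :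
    q - (7 / 6 : ℝ) ^ (-s) * (71 / 72) ^ N ≤ prob U S (vote m φ A₀ A₁ N s) (initial ψ) := by
  induction N generalizing s with
  | zero =>
    rw [vote, pow_zero, mul_one]
    split_ifs with hs
    · have : (0 : ℝ) < (7 / 6) ^ (-s) := by positivity
      linarith
    · have := one_le_zpow₀ (by norm_num : (1 : ℝ) ≤ 7 / 6) (by omega : 0 ≤ -s)
      exact le_trans (by linarith) (prob_nonneg U S A₀ _)
  | succ N ih =>
    rw [vote, prob_hadamardTest h]
    have hc' := Real.neg_one_le_cos (φ - m * lam)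
    have i₀ := mul_le_mul_of_nonneg_left (ih (s - 1))
      (by linarith : 0 ≤ (1 + Real.cos (φ - m * lam)) / 2)
    have i₁ := mul_le_mul_of_nonneg_left (ih (s + 1))
      (by linarith : 0 ≤ (1 - Real.cos (φ - m * lam)) / 2)
    rw [show -(s - 1) = -s + 1 by ring, zpow_add_one₀ (by norm_num)] at i₀
    rw [show -(s + 1) = -s - 1 by ring, zpow_sub_one₀ (by norm_num)] at i₁
    refine le_trans ?_ (add_le_add i₀ i₁)
    have : (0 : ℝ) < (7 / 6) ^ (-s) * (71 / 72) ^ N := by positivity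
    rw [pow_succ]
    nlinarith [mul_nonneg this.le (sub_nonneg.2 hφ)]

end Vote

/-! ### Ternary search -/

/-- Ternary search for the phase in `[a, a + π (2/3)^t]`, with `T` rounds left and `N` Hadamard
tests in each round. A round discards the left or the right third of the interval. -/
noncomputable def search (N : ℕ) : ℕ → ℕ → ℝ → Algorithm
  | 0, t, a => output (a + Real.pi * (2 / 3) ^ t / 2)
  | T + 1, t, a =>
    vote ⌊(3 / 2 : ℝ) ^ t⌋₊
      (⌊(3 / 2 : ℝ) ^ t⌋₊ * (a + Real.pi * (2 / 3) ^ t / 2) - Real.pi / 2)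
      (search N T (t + 1) a) (search N T (t + 1) (a + Real.pi * (2 / 3) ^ t / 3)) N 0

/-- The sum telescopes, since `(3/2)^t = 2 * ((3/2)^(t+1) - (3/2)^t)`. -/
theorem queries_search_le (N T t : ℕ) (a : ℝ) :
    ((search N T t a).queries : ℝ) ≤ N * (2 * ((3 / 2) ^ (t + T) - (3 / 2) ^ t)) := by
  induction T generalizing t a with
  | zero => simp [search, queries]
  | succ T ih =>
    have hf : (⌊(3 / 2 : ℝ) ^ t⌋₊ : ℝ) ≤ (3 / 2) ^ t := Nat.floor_le (by positivity)
    have hv := queries_vote_le ⌊(3 / 2 : ℝ) ^ t⌋₊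
      (⌊(3 / 2 : ℝ) ^ t⌋₊ * (a + Real.pi * (2 / 3) ^ t / 2) - Real.pi / 2)
      (search N T (t + 1) a) (search N T (t + 1) (a + Real.pi * (2 / 3) ^ t / 3)) N 0
    have hv' := (Nat.cast_le (α := ℝ)).2 hv
    push_cast at hv'
    have hm := max_le (ih (t + 1) a) (ih (t + 1) (a + Real.pi * (2 / 3) ^ t / 3))
    rw [search]
    refine hv'.trans ((add_le_add hm (mul_le_mul_of_nonneg_left hf N.cast_nonneg)).trans
      (le_of_eq ?_))
    rw [show t + 1 + T = t + (T + 1) by ring, pow_succ (3 / 2 : ℝ) t]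
    ring

theorem gates_search_le (N T t : ℕ) (a : ℝ) : (search N T t a).gates ≤ T * (N * 3) := by
  induction T generalizing t a with
  | zero => simp [search, gates]
  | succ T ih =>
    rw [search, add_mul, one_mul]
    exact (gates_vote_le _ _ _ _ _ _).trans (Nat.add_le_add_right (max_le (ih _ _) (ih _ _)) _)

/-- The offset `-π/2` makes the bias an odd function of `mid - lam`, so its sign tells the side of
the midpoint. -/
theorem cos_shift (m mid lam : ℝ) :
    Real.cos (m * mid - Real.pi / 2 - m * lam) = Real.sin (m * (mid - lam)) := by
  rw [← Real.cos_sub_pi_div_two]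
  congr 1
  ring

theorem le_prob_search {n : ℕ} {U : Op n} {ψ : Basis n → ℂ} {lam : ℝ}
    (h : U *ᵥ ψ = Complex.exp (-Complex.I * lam) • ψ) (hψ : normSq ψ = 1) (N T t : ℕ) (a ε : ℝ)
    (hε : Real.pi * (2 / 3) ^ (t + T) / 2 ≤ ε) (ha : a ≤ lam)
    (ha' : lam ≤ a + Real.pi * (2 / 3) ^ t) :
    1 - T * (71 / 72 : ℝ) ^ N ≤
      prob U {est : ℝ | |est - lam| ≤ ε} (search N T t a) (initial ψ) := by
  induction T generalizing t a with
  | zero =>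
    rw [search, prob, if_pos, normSq_initial, hψ]
    · simp
    · rw [add_zero] at hε
      rw [Set.mem_ofPred_eq, abs_le]
      constructor <;> linarith
  | succ T ih =>
    set L := Real.pi * (2 / 3) ^ t with hL
    have hLpos : 0 < L := by positivity
    have hL' : Real.pi * (2 / 3) ^ (t + 1) = 2 / 3 * L := by rw [hL, pow_succ]; ring
    have hε' : Real.pi * (2 / 3) ^ (t + 1 + T) / 2 ≤ ε := by
      rwa [show t + 1 + T = t + (T + 1) by ring]
    have i₀ := ih (t + 1) a hε' ha
    have i₁ := ih (t + 1) (a + L / 3) hε'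
    rw [hL'] at i₀ i₁
    have hρ : (0 : ℝ) ≤ (71 / 72) ^ N := by positivity
    have hq : 1 - (T : ℝ) * (71 / 72) ^ N ≤ 1 := by
      have : 0 ≤ (T : ℝ) * (71 / 72) ^ N := by positivity
      linarith
    set x : ℝ := (3 / 2) ^ t with hx
    have hx1 : 1 ≤ x := one_le_pow₀ (by norm_num)
    have hxL : x * L = Real.pi := by
      rw [hx, hL, mul_left_comm, ← mul_pow]
      norm_num
    set m : ℕ := ⌊x⌋₊ with hm
    have hmx : (m : ℝ) ≤ x := Nat.floor_le (by linarith)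
    -- Rounding down costs at most a factor two because `x ≥ 1`.
    have hmx' : x / 2 ≤ m := by
      have h1 : x < m + 1 := Nat.lt_floor_add_one x
      have h2 : (1 : ℝ) ≤ m := by exact_mod_cast Nat.le_floor (by simpa using hx1)
      linarith
    -- the bias of the test outside the middle third
    have bias : ∀ d : ℝ, L / 6 ≤ d → d ≤ L / 2 → 1 / 6 ≤ Real.sin (m * d) := by
      intro d hd hd'
      have hlo : Real.pi / 12 ≤ m * d := by
        have : x / 2 * (L / 6) ≤ m * d := by gcongr
        linarith
      have hhi : m * d ≤ Real.pi / 2 := by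
        have : m * d ≤ x * (L / 2) := by gcongr; linarith
        linarith
      -- Jordan's inequality `sin y ≥ 2 y / π` on `[0, π/2]`, used with `y ≥ π/12`.
      refine le_trans ?_ (Real.mul_le_sin (by linarith [Real.pi_pos]) hhi)
      calc (1 / 6 : ℝ) = 2 / Real.pi * (Real.pi / 12) := by
            field_simp; norm_num
        _ ≤ 2 / Real.pi * (m * d) := by gcongr
    rw [search, ← hL, ← hx, ← hm]
    push_cast
    rcases lt_or_ge lam (a + L / 3) with hl | hl
    · have hb := bias (a + L / 2 - lam) (by linarith) (by linarith)
      have := le_prob_vote_of_left h {est : ℝ | |est - lam| ≤ ε}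
        (search N T (t + 1) (a + L / 3)) hq (i₀ (by linarith))
        (φ := m * (a + L / 2) - Real.pi / 2) (m := m) (by rwa [cos_shift]) N 0
      rw [zpow_zero] at this
      linarith
    rcases lt_or_ge (a + 2 * L / 3) lam with hr | hr
    · have hb := bias (lam - (a + L / 2)) (by linarith) (by linarith)
      have := le_prob_vote_of_right h {est : ℝ | |est - lam| ≤ ε}
        (search N T (t + 1) a) hq (i₁ (by linarith) (by linarith))
        (φ := m * (a + L / 2) - Real.pi / 2) (m := m) (by
          rw [cos_shift, ← neg_sub, mul_neg, Real.sin_neg]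
          linarith) N 0
      rw [neg_zero, zpow_zero] at this
      linarith
    -- In the middle third the coin may be fair, but both candidate intervals contain `lam`.
    · have := le_prob_vote_of_both h {est : ℝ | |est - lam| ≤ ε} m
        (m * (a + L / 2) - Real.pi / 2) (i₀ (by linarith)) (i₁ (by linarith) (by linarith)) N 0
      linarith

end Algorithm

/-! ### Choice of parameters and final bounds -/

/-- The number of rounds of the search for a given precision. -/
theorem exists_rounds {ε : ℝ} (hε : 0 < ε) (hε' : ε < Real.exp (-1)) :
    ∃ T : ℕ, 1 ≤ T ∧ Real.pi * (2 / 3) ^ T / 2 ≤ ε ∧ (3 / 2 : ℝ) ^ T ≤ 3 * ε⁻¹ ∧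
      (T : ℝ) ≤ 7 * Real.log ε⁻¹ := by
  have hπ := Real.pi_gt_three
  have hπ' := Real.pi_lt_d2
  have hε1 : ε < 1 := hε'.trans (by simp)
  have hlog : 1 < Real.log ε⁻¹ := by
    rw [Real.log_inv, lt_neg]
    exact (Real.log_lt_iff_lt_exp hε).2 hε'
  have hinv : 1 < ε⁻¹ := (one_lt_inv₀ hε).2 hε1
  obtain ⟨k, hk, hk'⟩ := exists_nat_pow_near (x := Real.pi / 2 * ε⁻¹) (y := 3 / 2)
    (by nlinarith) (by norm_num)
  refine ⟨k + 1, by omega, ?_, ?_, ?_⟩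
  · have h1 : (3 / 2 : ℝ) ^ (k + 1) * (2 / 3) ^ (k + 1) = 1 := by rw [← mul_pow]; norm_num
    have h2 : (0 : ℝ) < (2 / 3) ^ (k + 1) := by positivity
    have h3 := mul_le_mul_of_nonneg_right hk'.le (mul_pos h2 hε).le
    calc Real.pi * (2 / 3) ^ (k + 1) / 2
        = Real.pi / 2 * ε⁻¹ * ((2 / 3) ^ (k + 1) * ε) := by field_simp
      _ ≤ _ := h3
      _ = ε := by rw [← mul_assoc, h1, one_mul]
  · rw [pow_succ]
    nlinarith
  · have h1 : (k : ℝ) * Real.log (3 / 2) ≤ Real.log (Real.pi / 2 * ε⁻¹) := by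
      rw [← Real.log_pow]
      exact Real.log_le_log (by positivity) hk
    have h2 : 1 / 3 ≤ Real.log (3 / 2) := by
      have := Real.one_sub_inv_le_log_of_pos (by norm_num : (0 : ℝ) < 3 / 2)
      norm_num at this ⊢
      linarith
    rw [Real.log_mul (by positivity) (by positivity)] at h1
    have h3 : Real.log (Real.pi / 2) ≤ 1 := by
      have := Real.log_le_sub_one_of_pos (by positivity : 0 < Real.pi / 2)
      linarith
    have h4 : (k : ℝ) * (1 / 3) ≤ k * Real.log (3 / 2) := by gcongr
    push_cast
    linarith

end PhaseEstimation

theorem mainTheorem8 (η : ℝ) (hη : 0 < η) :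
    ∃ (C : ℝ) (k : ℕ), 0 < C ∧
      ∀ ε ϑ : ℝ, 0 < ε → ε < Real.exp (-1) → 0 < ϑ → ϑ ≤ 1 / 2 →
        ∃ A : PhaseEstimation.Algorithm,
          (A.queries : ℝ) ≤
              C * (ε⁻¹ * Real.log ϑ⁻¹) * (1 + Real.log (ε⁻¹ * Real.log ϑ⁻¹)) ^ k ∧
          (A.gates : ℝ) ≤ C * (ε⁻¹ * (Real.log ϑ⁻¹ + Real.log (Real.log ε⁻¹))) ∧
          ∀ (n : ℕ) (H : PhaseEstimation.Op n) (ψ : PhaseEstimation.Basis n → ℂ) (lam : ℝ),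
            H.IsHermitian →
            PhaseEstimation.normSq ψ = 1 →
            Matrix.mulVec (PhaseEstimation.evolution H) ψ
              = Complex.exp (-Complex.I * (lam : ℂ)) • ψ →
            lam ∈ Set.Icc η (Real.pi - η) →
            1 - ϑ ≤ A.prob (PhaseEstimation.evolution H) {est : ℝ | |est - lam| ≤ ε}
              (PhaseEstimation.initial ψ) := by
  -- Any constant above `6516` (queries) and `7602` (gates) works.
  refine ⟨10000, 1, by norm_num, fun ε ϑ hε hε' hϑ hϑ' => ?_⟩
  obtain ⟨T, hT1, hTε, hTpow, hTlog⟩ := PhaseEstimation.exists_rounds hε hε'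
  have hlog : 1 < Real.log ε⁻¹ := by
    rw [Real.log_inv, lt_neg]
    exact (Real.log_lt_iff_lt_exp hε).2 hε'
  have hTpos : (0 : ℝ) < T := by exact_mod_cast hT1
  have hb : 1 / 2 ≤ Real.log ϑ⁻¹ := by
    have h2 : Real.log 2 ≤ Real.log ϑ⁻¹ :=
      Real.log_le_log (by norm_num) ((le_inv_comm₀ (by norm_num) hϑ).2 (by linarith))
    linarith [Real.log_two_gt_d9]
  have hll : 0 < Real.log (Real.log ε⁻¹) := Real.log_pos hlog
  have hinv : Real.log ε⁻¹ ≤ ε⁻¹ := (Real.log_le_sub_one_of_pos (by positivity)).trans (by linarith)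
  have hTl : Real.log T ≤ 2 + Real.log (Real.log ε⁻¹) := by
    have h7 : Real.log 7 ≤ 2 := by
      rw [Real.log_le_iff_le_exp (by norm_num)]
      have := Real.exp_one_gt_d9
      rw [show (2 : ℝ) = 1 + 1 by norm_num, Real.exp_add]
      nlinarith
    have := Real.log_le_log hTpos hTlog
    rw [Real.log_mul (by norm_num) (by positivity)] at this
    linarith
  have hT0 : 0 ≤ Real.log T := Real.log_nonneg (by exact_mod_cast hT1)
  set b := Real.log ϑ⁻¹ with hbdef
  set l := Real.log (Real.log ε⁻¹) with hldef
  -- The ceiling is at most `72 (b + l) + 145`, and `145 ≤ 290 b` since `b ≥ 1/2`; hence `362`.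
  obtain ⟨N, hN, hN'⟩ : ∃ N : ℕ, 72 * (Real.log T + b) ≤ N ∧ (N : ℝ) ≤ 362 * (b + l) := by
    refine ⟨⌈72 * (Real.log T + b)⌉₊, Nat.le_ceil _, ?_⟩
    have := Nat.ceil_lt_add_one (by positivity : 0 ≤ 72 * (Real.log T + b))
    linarith
  have hfail : (T : ℝ) * (71 / 72) ^ N ≤ ϑ := by
    have h1 : (71 / 72 : ℝ) ≤ Real.exp (-(1 / 72)) := by
      have := Real.add_one_le_exp (-(1 / 72) : ℝ)
      linarith
    calc (T : ℝ) * (71 / 72) ^ N ≤ Real.exp (Real.log T) * Real.exp (-(1 / 72)) ^ N := by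
          rw [Real.exp_log hTpos]
          gcongr
      _ = Real.exp (Real.log T + N * -(1 / 72)) := by rw [← Real.exp_nat_mul, Real.exp_add]
      _ ≤ Real.exp (Real.log ϑ) := by
          rw [Real.exp_le_exp]
          have : b = -Real.log ϑ := Real.log_inv ϑ
          linarith
      _ = ϑ := Real.exp_log hϑ
  -- This absorbs the `log log ε⁻¹` in `N` into a single logarithmic factor of the query bound, so
  -- `k = 1` suffices.
  have hlg : l ≤ 1 + Real.log (ε⁻¹ * b) := by
    have h1 : l ≤ Real.log ε⁻¹ :=
      (Real.log_le_sub_one_of_pos (by linarith)).trans (by linarith)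
    have h2 : -1 ≤ Real.log b := by
      have := Real.log_le_log (by norm_num) hb
      rw [one_div, Real.log_inv] at this
      linarith [Real.log_two_lt_d9]
    rw [Real.log_mul (by positivity) (by positivity)]
    linarith
  have hg : 0 ≤ Real.log (ε⁻¹ * b) := by
    refine Real.log_nonneg ?_
    have h2 : 2 ≤ ε⁻¹ := by
      have h3 := Real.exp_le_exp.2 hlog.le
      rw [Real.exp_log (by positivity)] at h3
      linarith [Real.exp_one_gt_d9]
    nlinarith
  have hεi : 0 < ε⁻¹ := by positivity
  refine ⟨PhaseEstimation.Algorithm.search N T 0 0, ?_, ?_, ?_⟩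
  · refine (PhaseEstimation.Algorithm.queries_search_le N T 0 0).trans ?_
    rw [zero_add, pow_zero, pow_one]
    have h1 : b + l ≤ 3 * (b * (1 + Real.log (ε⁻¹ * b))) := by nlinarith
    calc (N : ℝ) * (2 * ((3 / 2) ^ T - 1)) ≤ 362 * (b + l) * (2 * (3 * ε⁻¹)) := by
          have h2 : (1 : ℝ) ≤ (3 / 2) ^ T := one_le_pow₀ (by norm_num)
          exact mul_le_mul hN' (by linarith) (by linarith) (by linarith)
      _ ≤ 362 * (3 * (b * (1 + Real.log (ε⁻¹ * b)))) * (2 * (3 * ε⁻¹)) := by gcongr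
      _ = 6516 * (ε⁻¹ * b * (1 + Real.log (ε⁻¹ * b))) := by ring
      _ ≤ 10000 * (ε⁻¹ * b * (1 + Real.log (ε⁻¹ * b))) := by gcongr; norm_num
      _ = _ := by ring
  · have h1 := (Nat.cast_le (α := ℝ)).2 (PhaseEstimation.Algorithm.gates_search_le N T 0 0)
    push_cast at h1
    calc _ ≤ (T : ℝ) * (N * 3) := h1
      _ ≤ 7 * ε⁻¹ * (362 * (b + l) * 3) := by
          gcongr
          linarith
      _ = 7602 * (ε⁻¹ * (b + l)) := by ring
      _ ≤ _ := by gcongr; norm_num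
  · intro n H ψ lam _ hψ hU hlam
    have := PhaseEstimation.Algorithm.le_prob_search hU hψ N T 0 0 ε (by rwa [zero_add])
      (hη.le.trans hlam.1) (by rw [zero_add, pow_zero, mul_one]; linarith [hlam.2])
    linarith
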